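/- A shift space over a finite alphabet $A$ is a closed subset $X\subseteq A^{\mathbb Z}$ with $\sigma(X)=X$, where $\sigma(x)_i=x_{i+1}$; $\mathcal B_n(X)$ is the set of words of length $n$ occurring in points of $X$, $\mathcal B(X)=\bigcup_{n\ge 0}\mathcal B_n(X)$, and $h(X)=\lim_{n\to\infty}\frac1n\log|\mathcal B_n(X)|$ is the entropy of $X$. A shift space $X$ is - of finite type if it is the set of all points in which no word of some fixed finite set of words occurs; - sofic if it is the set of label sequences of all bi-infinite paths of some finite labeled directed graph; - irreducible if for all $u,v\in\mathcal B(X)$ there is a word $w$ with $uwv\in\mathcal B(X)$; - non-wandering if for every $u\in\mathcal B(X)$ there is a word $w$ with $uwu\in\mathcal B(X)$. A component of $X$ is a non-empty irreducible shift space $X_0\subseteq X$ that is not properly contained in another irreducible shift space contained in $X$. A code $\phi:X\to Y$ is a map given by a block map, $\phi(x)_i=\Phi(x_{[i-m,i+n]})$ for some fixed integers $-m\le n$. It is finite-to-one if $\phi^{-1}(y)$ is finite for every $y\in Y$. It is semi-open if for every $l\in\mathbb N$ there is $k\in\mathbb N$ such that for every $u\in\mathcal B_{2l+1}(X)$ there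 is $v\in\mathcal B_{2k+1}(Y)$ with $\{y\in Y: y_{[-k,k]}=v\}\subseteq\phi(\{x\in X: x_{[-l,l]}=u\})$. **Theorem.** Let $X$ be a shift of finite type, $Y$ an irreducible sofic shift and $\phi:X\to Y$ a finite-to-one semi-open code. Then $X$ is non-wandering, and every component $X_0$ of $X$ satisfies $h(X_0)=h(X)$. -/

import Mathlib

open Filter Topology
open SymbolicDynamics.FullShift (Subshift)

namespace SemiOpenCodes

universe u v

/-! A shift space over a finite alphabet `A` (with the discrete topology) is Mathlib's
`Subshift A ℤ`: a closed subset of `ℤ → A` that is invariant under all powers of the shift. -/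

section Words

variable {A : Type u}

/-- The word `x_i x_{i+1} ⋯ x_{i+n-1}` of length `n`. -/
def block (x : ℤ → A) (i : ℤ) (n : ℕ) : List A :=
  List.ofFn fun j : Fin n => x (i + (j : ℕ))

theorem length_block (x : ℤ → A) (i : ℤ) (n : ℕ) : (block x i n).length = n := by
  simp [block]

theorem block_add (x : ℤ → A) (i : ℤ) (m n : ℕ) :
    block x i (m + n) = block x i m ++ block x (i + m) n := by
  simp [block, List.ofFn_add, add_assoc]

end Words

section ShiftSpaces

variable {A : Type u} [TopologicalSpace A]

/-- `𝓑_n(X)`: the set of words of length `n` that occur in points of `X`. -/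
def blocks (X : Subshift A ℤ) (n : ℕ) : Set (List A) :=
  {w | ∃ x ∈ X.carrier, ∃ i : ℤ, block x i n = w}

theorem block_mem_blocks {X : Subshift A ℤ} {x : ℤ → A} (hx : x ∈ X.carrier) (i : ℤ) (n : ℕ) :
    block x i n ∈ blocks X n :=
  ⟨x, hx, i, rfl⟩

theorem finite_blocks [Finite A] (X : Subshift A ℤ) (n : ℕ) : (blocks X n).Finite := by
  refine (List.finite_length_eq A n).subset ?_
  rintro w ⟨x, _, i, rfl⟩
  exact length_block x i n

/-- The language `𝓑(X)`: the set of all finite words that occur in points of `X`. -/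
def language (X : Subshift A ℤ) : Set (List A) :=
  ⋃ n : ℕ, blocks X n

/-- `X` is irreducible: any two words `u`, `v` of its language can be joined, in this order,
by a word `w` such that `uwv` is in the language. -/
def IsIrreducibleShift (X : Subshift A ℤ) : Prop :=
  ∀ u ∈ language X, ∀ v ∈ language X, ∃ w : List A, u ++ w ++ v ∈ language X

/-- `X` is non-wandering: for every word `u` of its language there is a word `w` such that
`uwu` is in the language. -/
def IsNonwandering (X : Subshift A ℤ) : Prop :=
  ∀ u ∈ language X, ∃ w : List A, u ++ w ++ u ∈ language X

/-- `X` is a shift of finite type: it consists of all points in which no word of some finite set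
`F` of forbidden words occurs. -/
def IsSFT (X : Subshift A ℤ) : Prop :=
  ∃ F : Set (List A), F.Finite ∧
    X.carrier = {x | ∀ w ∈ F, ∀ i : ℤ, block x i w.length ≠ w}

/-- `X₀` is an (irreducible) component of `X`: a non-empty irreducible subshift of `X` that is not
properly contained in another irreducible subshift of `X`. -/
def IsComponent (X₀ X : Subshift A ℤ) : Prop :=
  X₀.carrier.Nonempty ∧ X₀.carrier ⊆ X.carrier ∧ IsIrreducibleShift X₀ ∧
    ∀ Z : Subshift A ℤ, IsIrreducibleShift Z → X₀.carrier ⊆ Z.carrier → Z.carrier ⊆ X.carrier →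
      Z.carrier = X₀.carrier

/-- The entropy `h(X) = lim_{n → ∞} (1/n) log |𝓑_n(X)|`. The limit exists: see
`tendsto_entropy` below. -/
noncomputable def entropy (X : Subshift A ℤ) : ℝ :=
  limUnder atTop fun n : ℕ => Real.log ((blocks X n).ncard : ℝ) / n

theorem ncard_blocks_add_le [Finite A] (X : Subshift A ℤ) (m n : ℕ) :
    (blocks X (m + n)).ncard ≤ (blocks X m).ncard * (blocks X n).ncard := by
  rw [← Set.ncard_prod]
  refine (Set.ncard_le_ncard (t := (fun p : List A × List A => p.1 ++ p.2) ''
    (blocks X m ×ˢ blocks X n)) ?_ (((finite_blocks X m).prod (finite_blocks X n)).image _)).trans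
    (Set.ncard_image_le ((finite_blocks X m).prod (finite_blocks X n)))
  rintro w ⟨x, hx, i, rfl⟩
  exact ⟨(block x i m, block x (i + m) n),
    ⟨block_mem_blocks hx _ _, block_mem_blocks hx _ _⟩, (block_add x i m n).symm⟩

theorem tendsto_entropy [Finite A] (X : Subshift A ℤ) :
    Tendsto (fun n : ℕ => Real.log ((blocks X n).ncard : ℝ) / n) atTop (𝓝 (entropy X)) := by
  have hsub : Subadditive fun n : ℕ => Real.log ((blocks X n).ncard : ℝ) := by
    intro m n
    rcases X.carrier.eq_empty_or_nonempty with h | ⟨x, hx⟩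
    · have h0 : ∀ k, blocks X k = ∅ := fun k => by simp [blocks, h]
      simp [h0]
    · have hpos : ∀ k, 0 < ((blocks X k).ncard : ℝ) := fun k => by
        exact_mod_cast (Set.ncard_pos (finite_blocks X k)).2 ⟨_, block_mem_blocks hx 0 k⟩
      rw [← Real.log_mul (hpos m).ne' (hpos n).ne']
      exact Real.log_le_log (hpos _) (by exact_mod_cast ncard_blocks_add_le X m n)
  have hbdd : BddBelow (Set.range fun n : ℕ => Real.log ((blocks X n).ncard : ℝ) / n) := by
    refine ⟨0, ?_⟩
    rintro _ ⟨n, rfl⟩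
    exact div_nonneg (Real.log_natCast_nonneg _) n.cast_nonneg
  exact tendsto_nhds_limUnder ⟨_, hsub.tendsto_lim hbdd⟩

end ShiftSpaces

section Sofic

/-- A finite directed graph whose edges carry labels in `D`. Parallel edges and loops are
allowed. -/
structure LabeledGraph (D : Type v) where
  /-- the vertices -/
  V : Type
  /-- the edges -/
  E : Type
  finite_V : Finite V
  finite_E : Finite E
  /-- the initial vertex of an edge -/
  init : E → V
  /-- the terminal vertex of an edge -/
  term : E → V
  /-- the label of an edge -/
  label : E → D

/-- The edge shift `X_G`: all bi-infinite paths of the graph. -/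
def LabeledGraph.edgeShift {D : Type v} (G : LabeledGraph D) : Set (ℤ → G.E) :=
  {ξ | ∀ i : ℤ, G.term (ξ i) = G.init (ξ (i + 1))}

/-- `Y` is sofic: it is the set of all label sequences of the bi-infinite paths of some finite
labeled graph. -/
def IsSofic {D : Type v} [TopologicalSpace D] (Y : Subshift D ℤ) : Prop :=
  ∃ G : LabeledGraph D, Y.carrier = (fun ξ : ℤ → G.E => fun i => G.label (ξ i)) '' G.edgeShift

end Sofic

section Codes

variable {A : Type u} {D : Type v} [TopologicalSpace A] [TopologicalSpace D]
  {X : Subshift A ℤ} {Y : Subshift D ℤ}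

/-- `φ : X → Y` is a code: there are integers `-m ≤ n` and a block map `Φ : 𝓑_{m+n+1}(X) → D` with
`φ(x)_i = Φ(x_{[i-m,i+n]})` for all `x` and `i`. -/
def IsCode (φ : X.carrier → Y.carrier) : Prop :=
  ∃ m n : ℤ, -m ≤ n ∧ ∃ Φ : blocks X (m + n + 1).toNat → D,
    ∀ (x : X.carrier) (i : ℤ),
      (φ x).1 i = Φ ⟨block x.1 (i - m) (m + n + 1).toNat, block_mem_blocks x.2 _ _⟩

/-- The central cylinder `[u] = {x ∈ X : x_{[-l,l]} = u}`, for a word `u` of length `2l+1`. -/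
def centralCylinder (X : Subshift A ℤ) (l : ℕ) (u : List A) : Set X.carrier :=
  {x | block x.1 (-(l : ℤ)) (2 * l + 1) = u}

/-- `φ` is semi-open: for each `l` there is `k` such that the image of each central `2l+1` cylinder
of `X` contains a central `2k+1` cylinder of `Y`. Cylinders are those of words in the language, so
they are non-empty. -/
def IsSemiOpen (φ : X.carrier → Y.carrier) : Prop :=
  ∀ l : ℕ, ∃ k : ℕ, ∀ u ∈ blocks X (2 * l + 1), ∃ v ∈ blocks Y (2 * k + 1),
    centralCylinder Y k v ⊆ φ '' centralCylinder X l u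

/-- `φ` is finite-to-one: every point has finitely many preimages. -/
def IsFiniteToOne (φ : X.carrier → Y.carrier) : Prop :=
  ∀ y : Y.carrier, (φ ⁻¹' {y}).Finite

end Codes

end SemiOpenCodes

open SemiOpenCodes

/-! Non-wandering: semi-openness puts a cylinder of `Y` inside the image of a given cylinder of `X`.
Periodic points are dense in an irreducible sofic shift (`IsSofic.exists_periodic`), and a preimage
of a periodic point under a finite-to-one code is periodic (`HasRadius.exists_period`). So every
cylinder of `X` contains a periodic point.

Entropy: in a non-wandering shift of finite type, two words with the same ends and the same image
would be interchangeable at infinitely many places of a periodic point, giving an infinite fibre.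
Hence a word is determined by its ends and its image (`HasRadius.eq_of_image_eq`), so `Y` has, up to
a constant factor, at least as many words as `X`. Conversely, a component `X₀` contains every point
of `X` showing a long enough word of `X₀` (`IsComponent.mem_of_block_eq`). Semi-openness at that
word and irreducibility of `Y` make every word of `Y` occur in the image of `X₀`. Together, the word
counts of `X` and `X₀` differ by at most a constant factor. -/

namespace SemiOpenCodes

universe u v

/-! ### Words and periodic sequences -/

section Words

variable {A : Type u}

theorem block_eq_block_iff (x y : ℤ → A) (i j : ℤ) (n : ℕ) :
    block x i n = block y j n ↔ ∀ t : ℤ, 0 ≤ t → t < n → x (i + t) = y (j + t) := by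
  unfold block
  rw [List.ofFn_inj, funext_iff]
  constructor
  · intro h t h0 h1
    obtain ⟨k, rfl⟩ := Int.eq_ofNat_of_zero_le h0
    exact h ⟨k, by omega⟩
  · intro h k
    exact h k (by omega) (by have := k.2; omega)

theorem block_translate (x : ℤ → A) (g i : ℤ) (n : ℕ) :
    block (fun k => x (g + k)) i n = block x (g + i) n := by
  rw [block_eq_block_iff]
  intro t _ _
  simp only [add_assoc]

/-- The periodic sequence that repeats `x₀ ⋯ x_{p-1}`. -/
def repeatPrefix (x : ℤ → A) (p : ℤ) : ℤ → A := fun k => x (k % p)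

theorem repeatPrefix_of_lt (x : ℤ → A) {p k : ℤ} (h0 : 0 ≤ k) (h1 : k < p) :
    repeatPrefix x p k = x k := by
  rw [repeatPrefix, Int.emod_eq_of_lt h0 h1]

theorem repeatPrefix_add_mul (x : ℤ → A) (p k s : ℤ) :
    repeatPrefix x p (k + s * p) = repeatPrefix x p k := by
  simp [repeatPrefix]

theorem repeatPrefix_add_period (x : ℤ → A) (p k : ℤ) :
    repeatPrefix x p (k + p) = repeatPrefix x p k := by
  simp [repeatPrefix]

end Words

/-! ### Languages, memory and gluing -/

section ShiftSpaces

variable {A : Type u} [TopologicalSpace A] {X : Subshift A ℤ}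

theorem translate_mem {x : ℤ → A} (hx : x ∈ X.carrier) (g : ℤ) :
    (fun k => x (g + k)) ∈ X.carrier :=
  X.mapsTo g hx

theorem block_mem_language {x : ℤ → A} (hx : x ∈ X.carrier) (i : ℤ) (n : ℕ) :
    block x i n ∈ language X :=
  Set.mem_iUnion.2 ⟨n, block_mem_blocks hx i n⟩

theorem exists_block_zero_of_mem_blocks {n : ℕ} {w : List A} (hw : w ∈ blocks X n) :
    ∃ x ∈ X.carrier, block x 0 n = w := by
  obtain ⟨x, hx, i, rfl⟩ := hw
  exact ⟨_, translate_mem hx i, by rw [block_translate, add_zero]⟩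

/-- A word `uwv` of the language occurs at the origin of some point. -/
theorem exists_point_of_append_mem {u w v : List A} (h : u ++ w ++ v ∈ language X) :
    ∃ z ∈ X.carrier, block z 0 u.length = u ∧ block z (u.length + w.length : ℕ) v.length = v := by
  obtain ⟨n, hn⟩ := Set.mem_iUnion.1 h
  obtain ⟨z, hz, hzw⟩ := exists_block_zero_of_mem_blocks hn
  have hlen : n = u.length + w.length + v.length := by
    have := congrArg List.length hzw
    simpa [length_block, add_assoc] using this
  subst hlen
  rw [block_add, block_add, zero_add, zero_add] at hzw
  obtain ⟨h1, h2⟩ := List.append_inj hzw (by simp [length_block])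
  exact ⟨z, hz, (List.append_inj h1 (by simp [length_block])).1, h2⟩

theorem IsIrreducibleShift.exists_join (hX : IsIrreducibleShift X) {x x' : ℤ → A}
    (hx : x ∈ X.carrier) (hx' : x' ∈ X.carrier) (i i' : ℤ) (n n' : ℕ) :
    ∃ z ∈ X.carrier, ∃ q : ℕ, n ≤ q ∧ block z 0 n = block x i n ∧
      block z q n' = block x' i' n' := by
  obtain ⟨w, hw⟩ := hX _ (block_mem_language hx i n) _ (block_mem_language hx' i' n')
  obtain ⟨z, hz, h1, h2⟩ := exists_point_of_append_mem hw
  simp only [length_block] at h1 h2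
  exact ⟨z, hz, n + w.length, by omega, h1, h2⟩

theorem IsNonwandering.exists_recurrence (hX : IsNonwandering X) {x : ℤ → A}
    (hx : x ∈ X.carrier) (i : ℤ) (n : ℕ) :
    ∃ z ∈ X.carrier, ∃ q : ℕ, n ≤ q ∧ block z 0 n = block x i n ∧
      block z q n = block x i n := by
  obtain ⟨w, hw⟩ := hX _ (block_mem_language hx i n)
  obtain ⟨z, hz, h1, h2⟩ := exists_point_of_append_mem hw
  simp only [length_block] at h1 h2
  exact ⟨z, hz, n + w.length, by omega, h1, h2⟩

/-- `X` has memory `N`: a sequence belongs to `X` as soon as all its words of length `N` do. -/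
def HasMemory (X : Subshift A ℤ) (N : ℕ) : Prop :=
  ∀ y : ℤ → A, (∀ k : ℤ, block y k N ∈ blocks X N) → y ∈ X.carrier

theorem IsSFT.exists_hasMemory (hX : IsSFT X) : ∃ N₀ : ℕ, ∀ N ≥ N₀, HasMemory X N := by
  obtain ⟨F, hF, hXF⟩ := hX
  obtain ⟨N₀, hN₀⟩ := (hF.image List.length).bddAbove
  refine ⟨N₀, fun N hN y hy => ?_⟩
  rw [hXF]
  intro w hw i hwi
  obtain ⟨x, hx, j, hxj⟩ := hy i
  have hwN : w.length ≤ N := (hN₀ ⟨w, hw, rfl⟩).trans hN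
  rw [hXF] at hx
  refine hx w hw j (Eq.trans ?_ hwi)
  rw [block_eq_block_iff] at hxj ⊢
  exact fun t h0 h1 => hxj t h0 (by omega)

theorem HasMemory.mem {N : ℕ} (hX : HasMemory X N) {y : ℤ → A}
    (h : ∀ k : ℤ, ∃ x ∈ X.carrier, ∃ d : ℤ, ∀ j, k ≤ j → j < k + N → y j = x (j + d)) :
    y ∈ X.carrier := by
  refine hX y fun k => ?_
  obtain ⟨x, hx, d, hxy⟩ := h k
  refine ⟨x, hx, k + d, ?_⟩
  rw [block_eq_block_iff]
  intro t h0 h1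
  rw [hxy (k + t) (by omega) (by omega)]
  congr 1
  ring

/-- As `N ≤ p`, a window of length `N` meets at most one seam, and there the hypothesis lets `x`
itself be read past `p`. -/
theorem HasMemory.repeatPrefix_mem {N : ℕ} (hX : HasMemory X N) {x : ℤ → A}
    (hx : x ∈ X.carrier) {p : ℤ} (hp : 0 < p) (hNp : N ≤ p)
    (h : ∀ t : ℤ, 0 ≤ t → t < N → x (p + t) = x t) : repeatPrefix x p ∈ X.carrier := by
  refine hX.mem fun k => ⟨x, hx, k % p - k, fun j hj hj' => ?_⟩
  have hr := Int.emod_nonneg k hp.ne'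
  have hr' := Int.emod_lt_of_pos k hp
  have hk := Int.emod_add_mul_ediv k p
  have hj2 : j = (j + (k % p - k)) + (k / p) * p := by linarith [mul_comm p (k / p)]
  conv_lhs => rw [hj2, repeatPrefix_add_mul]
  generalize hm : j + (k % p - k) = m
  rcases lt_or_ge m p with hlt | hge
  · exact repeatPrefix_of_lt x (by omega) hlt
  · have := repeatPrefix_add_period x p (m - p)
    rw [sub_add_cancel] at this
    rw [this, repeatPrefix_of_lt x (by omega) (by omega), ← h (m - p) (by omega) (by omega)]
    congr 1
    ring

/-- Two points that agree on a window of length `N` can be glued along it. -/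
theorem HasMemory.glue {N : ℕ} (hX : HasMemory X N) {x x' : ℤ → A}
    (hx : x ∈ X.carrier) (hx' : x' ∈ X.carrier) {i d : ℤ}
    (h : ∀ j, i ≤ j → j < i + N → x j = x' (j + d)) :
    (fun j => if j < i + N then x j else x' (j + d)) ∈ X.carrier := by
  refine hX.mem fun k => ?_
  rcases lt_or_ge k i with hk | hk
  · exact ⟨x, hx, 0, fun j h1 h2 => by simp [show j < i + N by omega]⟩
  · refine ⟨x', hx', d, fun j h1 h2 => ?_⟩
    split_ifs with hj
    · exact h j (by omega) hj
    · rfl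

end ShiftSpaces

/-! ### Periodic points of irreducible sofic shifts -/

section Sofic

theorem LabeledGraph.repeatPrefix_mem_edgeShift {D : Type v} (G : LabeledGraph D) {ξ : ℤ → G.E}
    (hξ : ξ ∈ G.edgeShift) {p : ℤ} (hp : 0 < p) (h : G.init (ξ p) = G.init (ξ 0)) :
    repeatPrefix ξ p ∈ G.edgeShift := by
  intro i
  have hr := Int.emod_nonneg i hp.ne'
  have hr' := Int.emod_lt_of_pos i hp
  have hk := Int.emod_add_mul_ediv i p
  have hi : i = i % p + (i / p) * p := by linarith [mul_comm p (i / p)]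
  have hi' : i + 1 = (i % p + 1) + (i / p) * p := by linarith
  rw [hi', repeatPrefix_add_mul, show repeatPrefix ξ p i = ξ (i % p) from rfl, hξ]
  rcases lt_or_ge (i % p + 1) p with hlt | hge
  · rw [repeatPrefix_of_lt ξ (by omega) hlt]
  · have : i % p + 1 = p := by omega
    rw [this, h]
    simp [repeatPrefix]

variable {D : Type v} [TopologicalSpace D] {Y : Subshift D ℤ}

/-- Supplies occurrences for a pigeonhole on graph vertices. The gap `m` ensures that a period
stretching from one occurrence to another contains the whole word. -/
theorem IsIrreducibleShift.exists_occurrences (hY : IsIrreducibleShift Y) {y : ℤ → D}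
    (hy : y ∈ Y.carrier) (i : ℤ) (m n : ℕ) :
    ∃ z ∈ Y.carrier, ∃ S : Finset ℕ, ∃ T : ℕ, S.card = n ∧
      (∀ s ∈ S, s < T ∧ block z s m = block y i m) ∧
      ∀ s ∈ S, ∀ s' ∈ S, s < s' → s + m ≤ s' := by
  induction n with
  | zero => exact ⟨y, hy, ∅, 0, by simp⟩
  | succ n ih =>
    obtain ⟨z, hz, S, T, hcard, hS, hsep⟩ := ih
    obtain ⟨z', hz', q, hq, h1, h2⟩ := hY.exists_join hz hy 0 i (T + m) m
    rw [block_eq_block_iff] at h1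
    have hqS : q ∉ S := fun h => by have := (hS q h).1; omega
    refine ⟨z', hz', insert q S, q + 1, by simp [hqS, hcard], ?_, ?_⟩
    · intro s hs
      rcases Finset.mem_insert.1 hs with rfl | hs
      · exact ⟨by omega, h2⟩
      · obtain ⟨hsT, hsb⟩ := hS s hs
        refine ⟨by omega, Eq.trans ?_ hsb⟩
        rw [block_eq_block_iff]
        intro t ht0 ht1
        simpa using h1 (s + t) (by omega) (by push_cast; omega)
    · intro s hs s' hs' hlt
      rcases Finset.mem_insert.1 hs with rfl | hsS <;>
        rcases Finset.mem_insert.1 hs' with rfl | hsS'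
      · omega
      · have := (hS s' hsS').1; omega
      · have := (hS s hsS).1; omega
      · exact hsep s hsS s' hsS' hlt

/-- Periodic points are dense in an irreducible sofic shift. -/
theorem IsSofic.exists_periodic (hY : IsSofic Y) (hYirr : IsIrreducibleShift Y) {y : ℤ → D}
    (hy : y ∈ Y.carrier) (i g : ℤ) (m : ℕ) :
    ∃ z ∈ Y.carrier, ∃ p : ℤ, 0 < p ∧ (∀ k, z (k + p) = z k) ∧ block z g m = block y i m := by
  obtain ⟨G, hG⟩ := hY
  have := G.finite_V
  have := Fintype.ofFinite G.V
  obtain ⟨z, hz, S, T, hcard, hS, hsep⟩ :=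
    hYirr.exists_occurrences hy i m (Fintype.card G.V + 1)
  rw [hG] at hz
  obtain ⟨ξ, hξ, rfl⟩ := hz
  -- There are more occurrences than vertices, so two of them start at the same vertex and the path
  -- between them closes up.
  obtain ⟨s, hs, s', hs', hne, hinit⟩ : ∃ s ∈ S, ∃ s' ∈ S, s < s' ∧
      G.init (ξ s) = G.init (ξ s') := by
    obtain ⟨a, ha, b, hb, hab, h⟩ := Finset.exists_ne_map_eq_of_card_lt_of_maps_to
      (s := S) (t := Finset.univ) (f := fun s : ℕ => G.init (ξ s))
      (by rw [hcard, Finset.card_univ]; omega) (fun _ _ => Finset.mem_coe.2 (Finset.mem_univ _))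
    rcases lt_or_gt_of_ne hab with hlt | hlt
    · exact ⟨a, ha, b, hb, hlt, h⟩
    · exact ⟨b, hb, a, ha, hlt, h.symm⟩
  have hsm := hsep s hs s' hs' hne
  have hmem : repeatPrefix (fun k => ξ (s + k)) ((s' : ℤ) - s) ∈ G.edgeShift := by
    refine G.repeatPrefix_mem_edgeShift (fun k => ?_) (by omega) ?_
    · simpa only [add_assoc] using hξ (s + k)
    · simpa using hinit.symm
  have hzY : (fun k => G.label (repeatPrefix (fun k => ξ (s + k)) ((s' : ℤ) - s) k)) ∈
      Y.carrier := by
    rw [hG]; exact ⟨_, hmem, rfl⟩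
  refine ⟨_, translate_mem hzY (-g), (s' : ℤ) - s, by omega, fun k => ?_, ?_⟩
  · rw [← add_assoc, repeatPrefix_add_period]
  · rw [← (hS s hs).2, block_eq_block_iff]
    intro t h0 h1
    rw [← add_assoc, neg_add_cancel, zero_add, repeatPrefix_of_lt _ h0 (by omega)]

end Sofic

/-! ### Communicating words and components -/

section Components

variable {A : Type u} [TopologicalSpace A] {X X₀ : Subshift A ℤ} {N : ℕ}

theorem HasMemory.exists_glue (hX : HasMemory X N) {x x' : ℤ → A} (hx : x ∈ X.carrier)
    (hx' : x' ∈ X.carrier) {i i' : ℤ} (h : block x i N = block x' i' N) :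
    ∃ y ∈ X.carrier, (∀ k < i + N, y k = x k) ∧ ∀ k ≥ i, y k = x' (k + (i' - i)) := by
  have hagree : ∀ j, i ≤ j → j < i + N → x j = x' (j + (i' - i)) := by
    intro j h0 h1
    have := (block_eq_block_iff _ _ _ _ _).1 h (j - i) (by omega) (by omega)
    rw [add_sub_cancel] at this
    rw [this]
    congr 1
    ring
  refine ⟨_, hX.glue hx hx' hagree, fun k hk => by simp [hk], fun k hk => ?_⟩
  split_ifs with hk'
  · exact hagree k hk hk'
  · rfl

/-- Some point of `X` contains the word `a` of length `N` and, at the same place or further to the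
right, the word `b`. -/
def Reaches (X : Subshift A ℤ) (N : ℕ) (a b : List A) : Prop :=
  ∃ x ∈ X.carrier, ∃ i j : ℤ, i ≤ j ∧ block x i N = a ∧ block x j N = b

theorem HasMemory.reaches_trans (hX : HasMemory X N) {a b c : List A} (hab : Reaches X N a b)
    (hbc : Reaches X N b c) : Reaches X N a c := by
  obtain ⟨x, hx, i, j, hij, rfl, rfl⟩ := hab
  obtain ⟨x', hx', i', j', hij', h, rfl⟩ := hbc
  obtain ⟨y, hy, h1, h2⟩ := hX.exists_glue hx hx' h.symm
  refine ⟨y, hy, i, j + (j' - i'), by omega, ?_, ?_⟩ <;> rw [block_eq_block_iff] <;> intro t ht ht'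
  · exact h1 _ (by omega)
  · rw [h2 _ (by omega)]
    congr 1
    ring

/-- The points of `X` all of whose words of length `N` communicate with `a`. -/
def communicatingSubshift [Finite A] [DiscreteTopology A] (X : Subshift A ℤ) (N : ℕ)
    (a : List A) : Subshift A ℤ where
  carrier := {x | x ∈ X.carrier ∧
    ∀ i : ℤ, Reaches X N a (block x i N) ∧ Reaches X N (block x i N) a}
  isClosed := by
    refine X.isClosed.inter ?_
    change IsClosed {x | ∀ i : ℤ, Reaches X N a (block x i N) ∧ Reaches X N (block x i N) a}
    rw [Set.ofPred_forall]
    refine isClosed_iInter fun i => ?_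
    -- The condition at `i` depends only on `N` coordinates with discrete values.
    have hc : Continuous fun (x : ℤ → A) (j : Fin N) => x (i + (j : ℕ)) := by fun_prop
    exact (isClosed_discrete {g : Fin N → A |
      Reaches X N a (List.ofFn g) ∧ Reaches X N (List.ofFn g) a}).preimage hc
  mapsTo g x hx := by
    refine ⟨X.mapsTo g hx.1, fun i => ?_⟩
    have := hx.2 (g + i)
    rwa [← block_translate] at this

variable [Finite A] [DiscreteTopology A]

/-- A point is glued from `z` through `u`, a passage `x` in `X`, and `z'` from `v` on. Windows of
the passage lie between two words communicating with `a`, hence communicate with `a` too. -/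
theorem HasMemory.isIrreducibleShift_communicatingSubshift (hX : HasMemory X N) (a : List A) :
    IsIrreducibleShift (communicatingSubshift X N a) := by
  intro u hu v hv
  obtain ⟨n, z, hz, i, rfl⟩ := Set.mem_iUnion.1 hu
  obtain ⟨n', z', hz', j, rfl⟩ := Set.mem_iUnion.1 hv
  obtain ⟨x, hx, p, q, hpq, hp, hq⟩ :=
    hX.reaches_trans (hz.2 (i + n)).2 (hz'.2 (j - N)).1
  obtain ⟨y, hy, hy1, hy2⟩ := hX.exists_glue hz.1 hx hp.symm
  obtain ⟨q', hq'⟩ : ∃ q' : ℤ, q' = q - (p - (i + n)) := ⟨_, rfl⟩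
  have hyq : block y q' N = block z' (j - N) N := by
    rw [← hq, block_eq_block_iff]
    intro t h0 h1
    rw [hy2 _ (by omega)]
    congr 1
    omega
  obtain ⟨w, hw, hw1, hw2⟩ := hX.exists_glue hy hz'.1 hyq
  have hwZ : w ∈ (communicatingSubshift X N a).carrier := by
    refine ⟨hw, fun k => ?_⟩
    rcases le_or_gt k (i + n) with hk | hk
    · have : block w k N = block z k N := by
        rw [block_eq_block_iff]
        intro t h0 h1
        rw [hw1 _ (by omega), hy1 _ (by omega)]
      rw [this]
      exact hz.2 k
    rcases le_or_gt k q' with hk' | hk'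
    · have : block w k N = block x (k + (p - (i + n))) N := by
        rw [block_eq_block_iff]
        intro t h0 h1
        rw [hw1 _ (by omega), hy2 _ (by omega)]
        congr 1
        ring
      rw [this]
      exact ⟨hX.reaches_trans (hz.2 (i + n)).1 ⟨x, hx, p, _, by omega, hp, rfl⟩,
        hX.reaches_trans ⟨x, hx, _, q, by omega, rfl, hq⟩ (hz'.2 (j - N)).2⟩
    · have : block w k N = block z' (k + (j - N - q')) N := by
        rw [block_eq_block_iff]
        intro t h0 h1
        rw [hw2 _ (by omega)]
        congr 1
        ring
      rw [this]
      exact hz'.2 _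
  obtain ⟨L, hL⟩ := Int.eq_ofNat_of_zero_le (show 0 ≤ q' + N - (i + n) by omega)
  have hu' : block z i n = block w i n := by
    rw [block_eq_block_iff]
    intro t h0 h1
    rw [hw1 _ (by omega), hy1 _ (by omega)]
  have hv' : block z' j n' = block w (i + (n + L : ℕ)) n' := by
    rw [block_eq_block_iff]
    intro t h0 h1
    rw [hw2 _ (by omega)]
    congr 1
    omega
  refine ⟨block w (i + n) L, ?_⟩
  rw [hu', hv', ← block_add, ← block_add]
  exact block_mem_language hwZ _ _

/-- In a non-wandering shift with memory `N`, each component contains every point of the shift that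
shares a word of length `N` with it. -/
theorem IsComponent.mem_of_block_eq (h₀ : IsComponent X₀ X) (hX : HasMemory X N)
    (hnw : IsNonwandering X) {x₀ x : ℤ → A} (hx₀ : x₀ ∈ X₀.carrier) (hx : x ∈ X.carrier) {i₀ i : ℤ}
    (h : block x i N = block x₀ i₀ N) : x ∈ X₀.carrier := by
  obtain ⟨-, hsub, hirr, hmax⟩ := h₀
  -- By maximality the component is the whole communicating class of its word.
  rw [← hmax (communicatingSubshift X N (block x₀ i₀ N))
    (hX.isIrreducibleShift_communicatingSubshift _) ?_ fun y hy => hy.1]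
  · have hrec : ∀ j k : ℤ, j ≤ k → Reaches X N (block x k N) (block x j N) := by
      intro j k hjk
      obtain ⟨m, hm⟩ := Int.eq_ofNat_of_zero_le (sub_nonneg.2 hjk)
      -- The word covering both windows recurs: the window at `k` in the first copy precedes the
      -- window at `j` in the second.
      obtain ⟨z, hz, q, hq, h1, h2⟩ := hnw.exists_recurrence hx j (m + N)
      rw [block_eq_block_iff] at h1 h2
      refine ⟨z, hz, m, q, by omega, ?_, ?_⟩ <;> rw [block_eq_block_iff] <;> intro t h0 ht
      · have := h1 (m + t) (by omega) (by omega)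
        rw [zero_add] at this
        rw [this]
        congr 1
        omega
      · exact h2 t h0 (by omega)
    refine ⟨hx, fun k => ?_⟩
    rw [← h]
    rcases le_total i k with hik | hik
    · exact ⟨⟨x, hx, i, k, hik, rfl, rfl⟩, hrec _ _ hik⟩
    · exact ⟨hrec _ _ hik, ⟨x, hx, k, i, hik, rfl, rfl⟩⟩
  · have hreach : ∀ y ∈ X₀.carrier, ∀ y' ∈ X₀.carrier, ∀ j j' : ℤ,
        Reaches X N (block y j N) (block y' j' N) := by
      intro y hy y' hy' j j'
      obtain ⟨z, hz, q, -, h1, h2⟩ := hirr.exists_join hy hy' j j' N N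
      exact ⟨z, hsub hz, 0, q, by omega, h1, h2⟩
    exact fun y hy => ⟨hsub hy, fun k => ⟨hreach _ hx₀ _ hy _ _, hreach _ hy _ hx₀ _ _⟩⟩

end Components

/-! ### Codes: periodic preimages, absence of diamonds, word counts -/

section Codes

variable {A : Type u} {D : Type v} [TopologicalSpace A] [TopologicalSpace D]
  {X : Subshift A ℤ} {Y : Subshift D ℤ} {φ : X.carrier → Y.carrier} {M N : ℕ}

/-- `φ` commutes with the shift, and `φ(x)_i` is determined by `x_{[i-M,i+M]}`. -/
def HasRadius (φ : X.carrier → Y.carrier) (M : ℕ) : Prop :=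
  ∀ (x x' : X.carrier) (i d : ℤ), (∀ j, i - M ≤ j → j ≤ i + M → x.1 j = x'.1 (j + d)) →
    (φ x).1 i = (φ x').1 (i + d)

theorem IsCode.exists_hasRadius (hφ : IsCode φ) : ∃ M : ℕ, HasRadius φ M := by
  obtain ⟨m, n, hmn, Φ, hΦ⟩ := hφ
  refine ⟨m.natAbs + n.natAbs, fun x x' i d h => ?_⟩
  rw [hΦ, hΦ]
  refine congrArg Φ (Subtype.ext ?_)
  rw [block_eq_block_iff]
  intro t h0 h1
  rw [h _ (by omega) (by omega)]
  exact congrArg x'.1 (by ring)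

theorem HasRadius.map_translate (hφ : HasRadius φ M) (x : X.carrier) (g : ℤ) :
    (φ ⟨_, translate_mem x.2 g⟩).1 = fun k => (φ x).1 (g + k) := by
  funext k
  rw [hφ ⟨_, translate_mem x.2 g⟩ x k g fun j _ _ => congrArg x.1 (add_comm g j), add_comm k g]

/-- A preimage of a periodic point under a finite-to-one code is periodic. -/
theorem HasRadius.exists_period (hφ : HasRadius φ M) (hfin : IsFiniteToOne φ) (x : X.carrier)
    {p : ℤ} (hp : 0 < p) (hper : ∀ k, (φ x).1 (k + p) = (φ x).1 k) :
    ∃ P : ℕ, 0 < P ∧ ∀ k, x.1 (k + P) = x.1 k := by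
  have hper' : ∀ (n : ℕ) (k : ℤ), (φ x).1 (n * p + k) = (φ x).1 k := by
    intro n k
    induction n with
    | zero => simp
    | succ n ih =>
      rw [← ih, ← hper (n * p + k)]
      exact congrArg (φ x).1 (by push_cast; ring)
  -- The translates of `x` by multiples of `p` all lie in one finite fibre, so two of them coincide.
  have hmaps : Set.MapsTo (fun n : ℕ => (⟨_, translate_mem x.2 (n * p)⟩ : X.carrier)) Set.univ
      (φ ⁻¹' {φ x}) := by
    intro n _
    refine Subtype.ext ?_
    rw [hφ.map_translate]
    exact funext fun k => hper' n k
  obtain ⟨a, -, b, -, hab, heq⟩ :=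
    Set.infinite_univ.exists_lt_map_eq_of_mapsTo hmaps (hfin (φ x))
  obtain ⟨P, hP⟩ := Int.eq_ofNat_of_zero_le (show 0 ≤ ((b : ℤ) - a) * p by
    have : (a : ℤ) < b := by exact_mod_cast hab
    nlinarith)
  refine ⟨P, ?_, fun k => ?_⟩
  · have : (a : ℤ) < b := by exact_mod_cast hab
    have : 0 < ((b : ℤ) - a) * p := mul_pos (by omega) hp
    omega
  · have := congrFun (congrArg Subtype.val heq) (k - a * p)
    dsimp only at this
    rw [add_sub_cancel] at this
    rw [this, ← hP]
    exact congrArg x.1 (by ring)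

theorem isNonwandering_of_finiteToOne_of_semiOpen (hYsofic : IsSofic Y)
    (hYirr : IsIrreducibleShift Y) (hφ : HasRadius φ M) (hfin : IsFiniteToOne φ)
    (hopen : IsSemiOpen φ) : IsNonwandering X := by
  intro u hu
  obtain ⟨n, x, hx, i, rfl⟩ := Set.mem_iUnion.1 hu
  -- Central cylinders have odd length, so the word of length `n` is prolonged to the right to
  -- length `2 * n + 1`.
  obtain ⟨k, hk⟩ := hopen n
  obtain ⟨v, ⟨y, hy, j, rfl⟩, hv⟩ := hk _ (block_mem_blocks hx i (2 * n + 1))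
  obtain ⟨z, hz, p, hp, hper, hzb⟩ := hYsofic.exists_periodic hYirr hy j (-k) (2 * k + 1)
  obtain ⟨x', hx'b, hx'z⟩ := hv (show (⟨z, hz⟩ : Y.carrier) ∈ _ from hzb)
  obtain ⟨P, hP, hPper⟩ := hφ.exists_period hfin x' hp (by rw [hx'z]; exact hper)
  have hPper' : ∀ (m : ℕ) (k : ℤ), x'.1 (k + (P * m : ℕ)) = x'.1 k := by
    intro m k
    induction m with
    | zero => simp
    | succ m ih =>
      rw [← ih, ← hPper (k + (P * m : ℕ))]
      exact congrArg x'.1 (by push_cast; ring)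
  -- The period `P * n` is at least `n`, so the second copy of the word does not overlap the first.
  obtain ⟨r, hr⟩ := Nat.exists_eq_add_of_le (Nat.le_mul_of_pos_left n hP)
  have hx'b : block x'.1 (-n) (2 * n + 1) = block x i (2 * n + 1) := hx'b
  rw [block_eq_block_iff] at hx'b
  have h1 : block x i n = block x'.1 (-n) n := by
    rw [block_eq_block_iff]
    exact fun t h0 h1 => (hx'b t h0 (by omega)).symm
  have h2 : block x i n = block x'.1 (-n + (n + r : ℕ)) n := by
    rw [h1, ← hr, block_eq_block_iff]
    intro t _ _
    rw [add_right_comm, hPper']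
  refine ⟨block x'.1 (-n + n) r, ?_⟩
  nth_rw 1 [h1]
  rw [h2, ← block_add, ← block_add]
  exact block_mem_language x'.2 _ _

/-- A finite-to-one code on a non-wandering shift of finite type has no diamonds. -/
theorem HasRadius.eq_of_image_eq (hφ : HasRadius φ M) (hX : HasMemory X N)
    (hnw : IsNonwandering X) (hfin : IsFiniteToOne φ) {K L : ℕ} (hNK : N ≤ K)
    (hMK : 2 * M + 1 ≤ K) {x x' : X.carrier} (hleft : block x.1 0 K = block x'.1 0 K)
    (hright : block x.1 L K = block x'.1 L K)
    (himage : block (φ x).1 0 (L + K) = block (φ x').1 0 (L + K)) :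
    block x.1 0 (L + K) = block x'.1 0 (L + K) := by
  by_contra hne
  rw [block_eq_block_iff] at hleft hright himage hne
  simp only [zero_add] at hleft himage hne
  push Not at hne
  obtain ⟨j₀, hj0, hj1, hj⟩ := hne
  obtain ⟨z, hz, p, hp, hz0, hzp⟩ := hnw.exists_recurrence x.2 0 (L + K)
  rw [block_eq_block_iff] at hz0 hzp
  simp only [zero_add] at hz0 hzp
  push_cast at hz0 hzp hj1 himage
  have hpZ : repeatPrefix z p ∈ X.carrier := by
    refine hX.repeatPrefix_mem hz (by omega) (by omega) fun t h0 h1 => ?_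
    rw [hzp t h0 (by omega), hz0 t h0 (by omega)]
  have hrep : ∀ s j : ℤ, s * p ≤ j → j < s * p + L + K →
      repeatPrefix z p j = x.1 (j - s * p) := by
    intro s j h0 h1
    have := repeatPrefix_add_mul z p (j - s * p) s
    rw [sub_add_cancel] at this
    rw [this, repeatPrefix_of_lt _ (by omega) (by omega), hz0 _ (by omega) (by omega)]
  -- The periodic point with its copy number `s` of the word of `x` replaced by that of `x'`.
  let w : ℤ → ℤ → A := fun s j =>
    if s * p ≤ j ∧ j < s * p + L + K then x'.1 (j - s * p) else repeatPrefix z p j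
  have hw_in : ∀ s j : ℤ, s * p ≤ j → j < s * p + L + K → w s j = x'.1 (j - s * p) :=
    fun s j h0 h1 => if_pos ⟨h0, h1⟩
  have hw_out : ∀ s j : ℤ, (j < s * p + K ∨ s * p + L ≤ j) → w s j = repeatPrefix z p j := by
    intro s j h
    by_cases hin : s * p ≤ j ∧ j < s * p + L + K
    · rw [hw_in s j hin.1 hin.2, hrep s j hin.1 hin.2]
      rcases h with h | h
      · exact (hleft _ (by omega) (by omega)).symm
      · have := hright (j - s * p - L) (by omega) (by omega)
        rw [add_sub_cancel] at this
        exact this.symm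
    · exact if_neg hin
  have hw : ∀ s, w s ∈ X.carrier := by
    intro s
    refine hX.mem fun k => ?_
    -- A window not inside the replaced copy meets it only within its outer `K` letters, as `N ≤ K`;
    -- there `x` and `x'` agree. The bound `2 * M + 1 ≤ K` serves likewise for the image.
    by_cases hk : s * p ≤ k ∧ k + N ≤ s * p + L + K
    · exact ⟨x', x'.2, -(s * p), fun j h0 h1 => hw_in s j (by omega) (by omega)⟩
    · exact ⟨_, hpZ, 0, fun j h0 h1 => by rw [add_zero]; exact hw_out s j (by omega)⟩
  have hmaps : Set.MapsTo (fun s : ℤ => (⟨w s, hw s⟩ : X.carrier)) Set.univ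
      (φ ⁻¹' {φ ⟨_, hpZ⟩}) := by
    intro s _
    refine Subtype.ext (funext fun i => ?_)
    by_cases hi : s * p ≤ i - M ∧ i + M < s * p + L + K
    · rw [hφ ⟨w s, hw s⟩ x' i (-(s * p)) fun j h0 h1 => hw_in s j (by omega) (by omega),
        hφ ⟨_, hpZ⟩ x i (-(s * p)) fun j h0 h1 => hrep s j (by omega) (by omega)]
      exact (himage _ (by omega) (by omega)).symm
    · have := hφ ⟨w s, hw s⟩ ⟨_, hpZ⟩ i 0 fun j h0 h1 => by
        rw [add_zero]; exact hw_out s j (by omega)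
      rwa [add_zero] at this
  obtain ⟨s, -, s', -, hss, heq⟩ :=
    Set.infinite_univ.exists_lt_map_eq_of_mapsTo hmaps (hfin _)
  have heq' : w s = w s' := congrArg Subtype.val heq
  -- At this place `w s` shows `x'` and `w s'` still shows `x`, which differ at `j₀`.
  have hval := congrFun heq' (s * p + j₀)
  have hlt : s * p + p ≤ s' * p := by nlinarith
  rw [hw_in s _ (by omega) (by omega), hw_out s' _ (Or.inl (by omega)),
    hrep s _ (by omega) (by omega), add_sub_cancel_left] at hval
  exact hj hval.symm

/-- The image near the ends of a word depends on letters outside it, so one point `pt w` is fixed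
per word. The two end blocks and the image block of that point then determine `w`. -/
theorem HasRadius.ncard_blocks_le [Finite A] [Finite D] (hφ : HasRadius φ M) (hX : HasMemory X N)
    (hnw : IsNonwandering X) (hfin : IsFiniteToOne φ) (hne : X.carrier.Nonempty) {K : ℕ}
    (hNK : N ≤ K) (hMK : 2 * M + 1 ≤ K) (L : ℕ) :
    (blocks X (L + K)).ncard ≤
      (blocks X K).ncard * (blocks X K).ncard * (blocks Y (L + K)).ncard := by
  have : Nonempty X.carrier := hne.to_subtype
  have hex : ∀ w : List A, ∃ x : X.carrier, w ∈ blocks X (L + K) → block x.1 0 (L + K) = w := by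
    intro w
    by_cases hw : w ∈ blocks X (L + K)
    · obtain ⟨x, hx, hxw⟩ := exists_block_zero_of_mem_blocks hw
      exact ⟨⟨x, hx⟩, fun _ => hxw⟩
    · exact ⟨Classical.arbitrary _, fun h => absurd h hw⟩
  choose pt hpt using hex
  rw [← Set.ncard_prod, ← Set.ncard_prod]
  refine Set.ncard_le_ncard_of_injOn
    (fun w => ((block (pt w).1 0 K, block (pt w).1 L K), block (φ (pt w)).1 0 (L + K)))
    (fun w _ => ⟨⟨block_mem_blocks (pt w).2 _ _, block_mem_blocks (pt w).2 _ _⟩,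
      block_mem_blocks (φ (pt w)).2 _ _⟩) ?_
    (((finite_blocks X K).prod (finite_blocks X K)).prod (finite_blocks Y _))
  intro w hw w' hw' heq
  simp only [Prod.mk.injEq] at heq
  rw [← hpt w hw, ← hpt w' hw']
  exact hφ.eq_of_image_eq hX hnw hfin hNK hMK heq.1.1 heq.1.2 heq.2

/-- If every word of `Y` occurs in the image of some point of `X₀`, then `Y` has at most as many
words of length `n` as `X₀` has words of length `n + 2M`. -/
theorem HasRadius.ncard_blocks_codomain_le [Finite A] (hφ : HasRadius φ M) {X₀ : Subshift A ℤ}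
    {n : ℕ} (h : ∀ w ∈ blocks Y n, ∃ x : X.carrier, x.1 ∈ X₀.carrier ∧
      ∃ i, block (φ x).1 i n = w) :
    (blocks Y n).ncard ≤ (blocks X₀ (n + 2 * M)).ncard := by
  rcases (blocks Y n).eq_empty_or_nonempty with hY | ⟨w₀, hw₀⟩
  · simp [hY]
  have : Nonempty X.carrier := ⟨(h w₀ hw₀).choose⟩
  choose! pt hpt pos hpos using h
  -- A preimage block widened by `M` on both sides determines the image word.
  refine Set.ncard_le_ncard_of_injOn (fun w => block (pt w).1 (pos w - M) (n + 2 * M))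
    (fun w hw => block_mem_blocks (hpt w hw) _ _) ?_ (finite_blocks X₀ _)
  intro w hw w' hw' heq
  rw [← hpos w hw, ← hpos w' hw', block_eq_block_iff]
  dsimp only at heq
  rw [block_eq_block_iff] at heq
  intro t h0 h1
  rw [hφ (pt w) (pt w') (pos w + t) (pos w' - pos w) fun j hj hj' => ?_]
  · exact congrArg (φ (pt w')).1 (by ring)
  · have := heq (j - (pos w - M)) (by omega) (by push_cast; omega)
    rw [add_sub_cancel] at this
    rw [this]
    exact congrArg (pt w').1 (by ring)

end Codes

/-! ### Entropy comparison and conclusion -/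

theorem entropy_eq_of_ncard_blocks_le {A : Type u} [Finite A] [TopologicalSpace A]
    {X X₀ : Subshift A ℤ} (hsub : X₀.carrier ⊆ X.carrier) (hne : X₀.carrier.Nonempty) {C : ℕ}
    (h : ∀ᶠ n in atTop, (blocks X n).ncard ≤ C * (blocks X₀ n).ncard) :
    entropy X₀ = entropy X := by
  obtain ⟨x, hx⟩ := hne
  have hpos : ∀ n, 0 < (blocks X₀ n).ncard := fun n =>
    (Set.ncard_pos (finite_blocks X₀ n)).2 ⟨_, block_mem_blocks hx 0 n⟩
  have hpos' : ∀ n, 0 < (blocks X n).ncard := fun n =>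
    (Set.ncard_pos (finite_blocks X n)).2 ⟨_, block_mem_blocks (hsub hx) 0 n⟩
  refine le_antisymm (le_of_tendsto_of_tendsto' (tendsto_entropy X₀) (tendsto_entropy X)
    fun n => ?_) ?_
  · have hle : (blocks X₀ n).ncard ≤ (blocks X n).ncard :=
      Set.ncard_le_ncard (fun w ⟨x, hx, i, hw⟩ => ⟨x, hsub hx, i, hw⟩) (finite_blocks X n)
    have := hpos n
    gcongr
  -- The factor `C` contributes `log C / n`, which vanishes in the limit.
  · have hlim : Tendsto (fun n : ℕ => Real.log C / n + Real.log ((blocks X₀ n).ncard : ℝ) / n)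
        atTop (𝓝 (0 + entropy X₀)) :=
      (tendsto_const_div_atTop_nhds_zero_nat _).add (tendsto_entropy X₀)
    rw [zero_add] at hlim
    refine le_of_tendsto_of_tendsto (tendsto_entropy X) hlim (h.mono fun n hn => ?_)
    have hC : C ≠ 0 := by
      rintro rfl
      have := hpos' n
      omega
    dsimp only
    rw [← add_div, ← Real.log_mul (by exact_mod_cast hC) (by exact_mod_cast (hpos n).ne')]
    have := hpos' n
    gcongr
    exact_mod_cast hn

end SemiOpenCodes

theorem theorem4p1 {A : Type*} [Finite A] [TopologicalSpace A] [DiscreteTopology A]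
    {D : Type*} [Finite D] [TopologicalSpace D] [DiscreteTopology D]
    (X : Subshift A ℤ) (Y : Subshift D ℤ) (hX : IsSFT X) (hYsofic : IsSofic Y)
    (hYirr : IsIrreducibleShift Y) (φ : X.carrier → Y.carrier) (hφ : IsCode φ)
    (hfin : IsFiniteToOne φ) (hopen : IsSemiOpen φ) :
    IsNonwandering X ∧ ∀ X₀ : Subshift A ℤ, IsComponent X₀ X → entropy X₀ = entropy X := by
  obtain ⟨M, hM⟩ := hφ.exists_hasRadius
  have hnw := isNonwandering_of_finiteToOne_of_semiOpen hYsofic hYirr hM hfin hopen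
  refine ⟨hnw, fun X₀ h₀ => ?_⟩
  obtain ⟨l, hl⟩ := hX.exists_hasMemory
  -- This length is both admissible as a memory and the length of a central cylinder, so
  -- semi-openness applies to words that detect the component.
  have hmem := hl (2 * l + 1) (by omega)
  obtain ⟨x₀, hx₀⟩ := h₀.1
  have hsub := h₀.2.1
  have hwords : ∀ n, ∀ w ∈ blocks Y n, ∃ x : X.carrier, x.1 ∈ X₀.carrier ∧
      ∃ i, block (φ x).1 i n = w := by
    rintro n w ⟨y, hy, j, rfl⟩
    obtain ⟨k, hk⟩ := hopen l
    obtain ⟨v, ⟨y', hy', j', rfl⟩, hv⟩ := hk _ (block_mem_blocks (hsub hx₀) 0 (2 * l + 1))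
    -- A point of `Y` showing both `v` and `w`: having `v` forces a preimage that shares a word with
    -- `X₀`, hence lies in `X₀`.
    obtain ⟨z, hz, q, -, h1, h2⟩ := hYirr.exists_join hy' hy j' j (2 * k + 1) n
    obtain ⟨x, hx, hxz⟩ := hv (show (⟨_, translate_mem hz k⟩ : Y.carrier) ∈ _ from by
      change block _ _ _ = _
      rw [block_translate, add_neg_cancel, h1])
    refine ⟨x, h₀.mem_of_block_eq hmem hnw hx₀ x.2 hx, q - k, ?_⟩
    rw [hxz]
    change block (fun i => z (k + i)) _ _ = _
    rw [block_translate, add_sub_cancel, h2]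
  obtain ⟨K, hK⟩ : ∃ K, K = 2 * l + 1 + (2 * M + 1) := ⟨_, rfl⟩
  refine entropy_eq_of_ncard_blocks_le hsub h₀.1
    (C := (blocks X K).ncard * (blocks X K).ncard * (blocks X₀ (2 * M)).ncard)
    (eventually_atTop.2 ⟨K, fun n hn => ?_⟩)
  obtain ⟨L, rfl⟩ := Nat.exists_eq_add_of_le' hn
  calc (blocks X (L + K)).ncard
      ≤ (blocks X K).ncard * (blocks X K).ncard * (blocks Y (L + K)).ncard :=
        hM.ncard_blocks_le hmem hnw hfin ⟨_, hsub hx₀⟩ (by omega) (by omega) L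
    _ ≤ (blocks X K).ncard * (blocks X K).ncard *
          ((blocks X₀ (L + K)).ncard * (blocks X₀ (2 * M)).ncard) :=
        Nat.mul_le_mul_left _ ((hM.ncard_blocks_codomain_le (hwords _)).trans
          (ncard_blocks_add_le _ _ _))
    _ = _ := by ring
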